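/- Let $A$ be a (not necessarily unital) exact $C^*$-algebra, i.e. one that admits a faithful nuclear $^*$-representation on a Hilbert space, and let $\alpha$ be a $^*$-automorphism of $A$. For a faithful $^*$-representation $\pi : A\to\mathcal{B}(\mathcal{H})$, a set $\Omega\subseteq A$ and $\delta>0$, let $\mathrm{rcp}(\Omega,\delta)\in\{0,1,2,\dots\}\cup\{\infty\}$ be the infimum of $\operatorname{rank} B$ over all triples $(\varphi,\psi,B)$, where $B$ is a finite-dimensional $C^*$-algebra, $\varphi : A\to B$ and $\psi : B\to\mathcal{B}(\mathcal{H})$ are contractive completely positive maps with $\|(\psi\circ\varphi)(a)-\pi(a)\|<\delta$ for all $a\in\Omega$, and $\operatorname{rank} B$ is the dimension of a maximal abelian $C^*$-subalgebra of $B$. The Voiculescu–Brown entropy of $\alpha$ is $$ht(\alpha)=\sup_{\Omega}\ \sup_{\delta>0}\ \limsup_{n\to\infty}\frac1n\log \mathrm{rcp}\bigl(\Omega\cup\alpha\Omega\cup\cdots\cup\alpha^{n-1}\Omega,\ \delta\bigr)\in[-\infty,\infty],$$ where $\Omega$ ranges over the finite subsets of $A$ and $\log 0=-\infty$. Let $A^{\mathrm{op}}$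 be the opposite $C^*$-algebra ($A$ with the multiplication reversed), write $\tilde a\in A^{\mathrm{op}}$ for the element corresponding to $a\in A$, and let $\alpha^{\mathrm{op}}$ be the automorphism of $A^{\mathrm{op}}$ given by $\alpha^{\mathrm{op}}(\tilde a)=\widetilde{\alpha(a)}$. Then $$ht(\alpha)=ht(\alpha^{\mathrm{op}}),$$ whichever faithful $^*$-representations of $A$ and of $A^{\mathrm{op}}$ on Hilbert spaces are used to compute the two sides. -/

import Mathlib

namespace VBEntropy

open scoped CStarAlgebra ComplexOrder ENNReal

universe u v

/-- The order of a star-ordered ring, carried over to the opposite ring, is again the order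
given by the elements `star x * x`. In particular the opposite of a C⋆-algebra with its standard
order is a C⋆-algebra with its standard order. -/
instance instStarOrderedRingMulOpposite {R : Type u} [NonUnitalRing R] [StarRing R]
    [PartialOrder R] [StarOrderedRing R] : StarOrderedRing Rᵐᵒᵖ := by
  refine StarOrderedRing.of_nonneg_iff (fun h z => by gcongr) (fun x => ?_)
  have key : AddSubmonoid.closure (Set.range fun s : Rᵐᵒᵖ => star s * s) =
      (AddSubmonoid.closure (Set.range fun s : R => star s * s)).map
        (MulOpposite.opAddEquiv : R ≃+ Rᵐᵒᵖ).toAddMonoidHom := by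
    rw [AddMonoidHom.map_mclosure]
    congr 1
    ext y
    constructor
    · rintro ⟨s, rfl⟩
      exact ⟨_, ⟨star s.unop, rfl⟩, by simp⟩
    · rintro ⟨_, ⟨s, rfl⟩, rfl⟩
      exact ⟨MulOpposite.op (star s), by simp⟩
  rw [← MulOpposite.unop_nonneg, StarOrderedRing.nonneg_iff, key]
  constructor
  · intro h
    exact ⟨x.unop, h, rfl⟩
  · rintro ⟨y, hy, rfl⟩
    exact hy

/-- The automorphism `αᵒᵖ` of the opposite algebra induced by an automorphism `α`: it sends the
element of `Aᵐᵒᵖ` corresponding to `a` to the one corresponding to `α a`. -/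
def opAut {A : Type u} [NonUnitalCStarAlgebra A] (α : A ≃⋆ₐ[ℂ] A) : Aᵐᵒᵖ ≃⋆ₐ[ℂ] Aᵐᵒᵖ where
  toFun a := MulOpposite.op (α a.unop)
  invFun a := MulOpposite.op (α.symm a.unop)
  left_inv a := by simp
  right_inv a := by simp
  map_mul' a b := by simp
  map_add' a b := by simp
  map_star' a := by simp [map_star]
  map_smul' r a := by simp

/-- A C⋆-algebra `A` is exact if it is nuclearly embeddable: it has a faithful ⋆-representation
`π` on a Hilbert space such that `π` is nuclear, i.e. can be approximated, on each finite set,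
by compositions of two contractive completely positive maps `A → Mₙ(ℂ) → B(H)`. -/
def IsExact (A : Type u) [NonUnitalCStarAlgebra A] [PartialOrder A] [StarOrderedRing A] : Prop :=
  ∃ (H : Type u) (_ : NormedAddCommGroup H) (_ : InnerProductSpace ℂ H) (_ : CompleteSpace H)
    (π : A →⋆ₙₐ[ℂ] (H →L[ℂ] H)), Function.Injective π ∧
    ∀ (Ω : Finset A) (δ : ℝ), 0 < δ →
      ∃ (n : ℕ) (φ : A →CP CStarMatrix (Fin n) (Fin n) ℂ)
        (ψ : CStarMatrix (Fin n) (Fin n) ℂ →CP (H →L[ℂ] H)),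
        (∀ a, ‖φ a‖ ≤ ‖a‖) ∧ (∀ b, ‖ψ b‖ ≤ ‖b‖) ∧ ∀ a ∈ Ω, ‖ψ (φ a) - π a‖ < δ

/-- The rank of a finite-dimensional C⋆-algebra: the dimension of a maximal abelian
C⋆-subalgebra (all of these have the same dimension; a ⋆-subalgebra is automatically closed). -/
noncomputable def cstarRank (B : Type v) [NonUnitalCStarAlgebra B] : ℕ :=
  sSup {d : ℕ | ∃ D : NonUnitalStarSubalgebra ℂ B,
    Maximal (fun S : NonUnitalStarSubalgebra ℂ B => ∀ x ∈ S, ∀ y ∈ S, x * y = y * x) D ∧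
      Module.finrank ℂ D = d}

section CPA

variable {A : Type u} [NonUnitalCStarAlgebra A] [PartialOrder A] [StarOrderedRing A]
  {H : Type v} [NormedAddCommGroup H] [InnerProductSpace ℂ H] [CompleteSpace H]

/-- `CPA π Ω δ`: the triples `(φ, ψ, B)` with `B` a finite-dimensional C⋆-algebra and
`φ : A → B`, `ψ : B → B(H)` contractive completely positive maps whose composition is
`δ`-close to `π` on `Ω`. (Every finite-dimensional C⋆-algebra is isomorphic to one whose
underlying type lives in the lowest universe.) -/
structure CPA (π : A →⋆ₙₐ[ℂ] (H →L[ℂ] H)) (Ω : Set A) (δ : ℝ) where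
  B : Type
  [cstar : NonUnitalCStarAlgebra B]
  [order : PartialOrder B]
  [starOrdered : StarOrderedRing B]
  [finiteDimensional : FiniteDimensional ℂ B]
  φ : A →CP B
  ψ : B →CP (H →L[ℂ] H)
  φ_contractive : ∀ a, ‖φ a‖ ≤ ‖a‖
  ψ_contractive : ∀ b, ‖ψ b‖ ≤ ‖b‖
  approx : ∀ a ∈ Ω, ‖ψ (φ a) - π a‖ < δ

/-- The rank of the finite-dimensional algebra in a triple. -/
noncomputable def CPA.rank {π : A →⋆ₙₐ[ℂ] (H →L[ℂ] H)} {Ω : Set A} {δ : ℝ} (T : CPA π Ω δ) : ℕ :=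
  letI := T.cstar
  cstarRank T.B

/-- The completely positive approximation rank `rcp(Ω, δ)`, computed in the representation `π`;
it is `⊤` if there is no approximating triple. -/
noncomputable def rcp (π : A →⋆ₙₐ[ℂ] (H →L[ℂ] H)) (Ω : Set A) (δ : ℝ) : ℕ∞ :=
  ⨅ T : CPA π Ω δ, (T.rank : ℕ∞)

/-- `Ω ∪ α Ω ∪ ⋯ ∪ α ^ (n - 1) Ω`. -/
def orbit (α : A ≃⋆ₐ[ℂ] A) (Ω : Set A) (n : ℕ) : Set A :=
  ⋃ k < n, (α^[k]) '' Ω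

/-- `ht(α, Ω, δ) = limsup (1 / n) log rcp(Ω ∪ ⋯ ∪ α ^ (n - 1) Ω, δ)`, an extended real, with
`log 0 = -∞` and `log ∞ = ∞`. -/
noncomputable def htDelta (π : A →⋆ₙₐ[ℂ] (H →L[ℂ] H)) (α : A ≃⋆ₐ[ℂ] A) (Ω : Set A) (δ : ℝ) :
    EReal :=
  Filter.limsup (fun n : ℕ =>
    (((1 : ℝ) / (n : ℝ) : ℝ) : EReal) * ENNReal.log ((rcp π (orbit α Ω n) δ : ℕ∞) : ℝ≥0∞))
    Filter.atTop

/-- `ht(α, Ω) = sup_{δ > 0} ht(α, Ω, δ)`. -/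
noncomputable def htSet (π : A →⋆ₙₐ[ℂ] (H →L[ℂ] H)) (α : A ≃⋆ₐ[ℂ] A) (Ω : Set A) : EReal :=
  ⨆ (δ : ℝ) (_ : 0 < δ), htDelta π α Ω δ

/-- The Voiculescu–Brown entropy `ht(α) = sup_Ω ht(α, Ω)`, over all finite subsets `Ω` of `A`,
computed in the representation `π`. -/
noncomputable def ht (π : A →⋆ₙₐ[ℂ] (H →L[ℂ] H)) (α : A ≃⋆ₐ[ℂ] A) : EReal :=
  ⨆ Ω : Finset A, htSet π α (Ω : Set A)

end CPA

end VBEntropy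

namespace VBEntropy

open scoped CStarAlgebra ComplexOrder ENNReal InnerProductSpace

/-! Reversing multiplication turns an approximating triple `(φ, ψ, B)` for `π` into completely
positive maps `Aᵐᵒᵖ → Bᵐᵒᵖ → B(H)ᵐᵒᵖ`, with `Bᵐᵒᵖ` of the same rank (`cstarRank_op`). The target is
not `B(K)`, and `ρ` is unrelated to `π`. Both obstacles fall to one dilation (`exists_dilation`):
since `πᵒᵖ` embeds `Aᵐᵒᵖ` in `B(H)ᵐᵒᵖ`, there are a representation `τ` of `B(H)ᵐᵒᵖ` and an isometry
`V` with `ρ = V* τ(πᵒᵖ(·)) V`. Compressing `τ ∘ ψᵒᵖ` by `V` gives a triple for `ρ` with no larger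
error. Hence one inequality of ranks; the other follows by symmetry through the double opposite.

The dilation is built by extending vector functionals positively (Hahn–Banach) and summing GNS
representations. -/

/-- Injective ⋆-homomorphisms of C⋆-algebras reflect positivity. -/
theorem nonneg_of_map_nonneg {X Y : Type*} [NonUnitalCStarAlgebra X] [PartialOrder X]
    [StarOrderedRing X] [NonUnitalCStarAlgebra Y] [PartialOrder Y] [StarOrderedRing Y]
    (h : X →⋆ₙₐ[ℂ] Y) (hh : Function.Injective h) {x : X} (hx : 0 ≤ h x) : 0 ≤ x := by
  have hsa : IsSelfAdjoint x := hh (by rw [map_star, (IsSelfAdjoint.of_nonneg hx).star_eq])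
  have hdec : h x = h x⁺ - h x⁻ := by
    rw [← map_sub, CFC.posPart_sub_negPart x]
  have hmul : h x⁺ * h x⁻ = 0 := by
    rw [← map_mul, CFC.posPart_mul_negPart, map_zero]
  -- By uniqueness, `h x⁺ - h x⁻` is the Jordan decomposition of `h x`, whose negative part
  -- vanishes.
  have hneg : h x⁻ = 0 := by
    rw [← (CFC.posPart_negPart_unique hdec hmul (map_nonneg h (CFC.posPart_nonneg x))
      (map_nonneg h (CFC.negPart_nonneg x))).2]
    exact (CFC.negPart_eq_zero_iff _ (IsSelfAdjoint.of_nonneg hx)).2 hx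
  exact (CFC.negPart_eq_zero_iff x hsa).1 (hh (by rw [hneg, map_zero]))

/-! ### Positive extension of functionals -/

section Extension

variable {D : Type*} [CStarAlgebra D]

/-- A functional with `‖g‖ ≤ g 1` is real on self-adjoint elements. -/
theorem im_eq_zero_of_norm_le_apply_one (g : D →L[ℂ] ℂ) {r : ℝ} (hg : ‖g‖ ≤ r) (h1 : g 1 = r)
    {a : D} (ha : IsSelfAdjoint a) : (g a).im = 0 := by
  have hr : 0 ≤ r := (norm_nonneg g).trans hg
  have key : ∀ t : ℝ, ((g a).im + t * r) ^ 2 ≤ r ^ 2 * (‖a‖ ^ 2 + t ^ 2 * ‖(1 : D)‖) := by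
    intro t
    set b : D := a + (Complex.I * t) • 1 with hb
    have hbb : star b * b = a * a + ((t ^ 2 : ℝ) : ℂ) • 1 := by
      simp only [hb, star_add, star_smul, star_one, ha.star_eq, add_mul, mul_add, smul_mul_assoc,
        mul_smul_comm, one_mul, mul_one, smul_add, smul_smul, RCLike.star_def, map_mul,
        Complex.conj_I, Complex.conj_ofReal]
      have : Complex.I * (t : ℂ) * (-Complex.I * t) = ((t ^ 2 : ℝ) : ℂ) := by
        push_cast; linear_combination (-(t : ℂ) ^ 2) * Complex.I_sq
      rw [this, neg_mul, neg_smul]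
      abel
    have hnb : ‖b‖ ^ 2 ≤ ‖a‖ ^ 2 + t ^ 2 * ‖(1 : D)‖ := by
      rw [sq, ← CStarRing.norm_star_mul_self, hbb]
      refine (norm_add_le _ _).trans (add_le_add ?_ ?_)
      · rw [sq]; exact norm_mul_le _ _
      · rw [norm_smul, Complex.norm_real, Real.norm_of_nonneg (sq_nonneg t)]
    have hgb : ‖g b‖ ≤ r * ‖b‖ := g.le_of_opNorm_le hg b
    have him : (g b).im = (g a).im + t * r := by
      simp [hb, h1]
    calc ((g a).im + t * r) ^ 2 = |(g b).im| ^ 2 := by rw [him, sq_abs]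
      _ ≤ ‖g b‖ ^ 2 := by gcongr; exact Complex.abs_im_le_norm _
      _ ≤ (r * ‖b‖) ^ 2 := by gcongr
      _ = r ^ 2 * ‖b‖ ^ 2 := by ring
      _ ≤ _ := by gcongr
  rcases subsingleton_or_nontrivial D with hD | hD
  · rw [Subsingleton.elim a 0]; simp
  simp only [CStarRing.norm_one, mul_one] at key
  rcases hr.eq_or_lt with rfl | hr'
  · have := key 0
    simp only [mul_zero, add_zero] at this
    nlinarith [sq_nonneg (g a).im]
  by_contra hne
  -- In `key` the terms `t² r²` cancel, leaving `im² + 2 t r im ≤ r²‖a‖²`; this `t` makes the middle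
  -- term `2 r²‖a‖²`.
  have := key (r * ‖a‖ ^ 2 / (g a).im)
  have h2 : r * ‖a‖ ^ 2 / (g a).im * (g a).im = r * ‖a‖ ^ 2 := div_mul_cancel₀ _ hne
  have h3 : 0 < (g a).im ^ 2 := by positivity
  nlinarith [sq_nonneg (r * ‖a‖)]

variable [PartialOrder D] [StarOrderedRing D]

/-- A functional with `‖g‖ ≤ g 1` is positive. -/
theorem apply_nonneg_of_norm_le_apply_one (g : D →L[ℂ] ℂ) {r : ℝ} (hg : ‖g‖ ≤ r)
    (h1 : g 1 = r) {a : D} (ha : 0 ≤ a) : 0 ≤ g a := by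
  have him := im_eq_zero_of_norm_le_apply_one g hg h1 (IsSelfAdjoint.of_nonneg ha)
  -- Applying `g` will give `r‖a‖ - re (g a) ≤ r‖a‖`.
  have hna : ‖algebraMap ℝ D ‖a‖ - a‖ ≤ ‖a‖ := by
    have h0 : 0 ≤ algebraMap ℝ D ‖a‖ - a :=
      sub_nonneg.2 (IsSelfAdjoint.of_nonneg ha).le_algebraMap_norm_self
    refine (CStarAlgebra.norm_le_norm_of_nonneg_of_le h0 (sub_le_self _ ha)).trans ?_
    rcases subsingleton_or_nontrivial D with hD | hD
    · rw [Subsingleton.elim (algebraMap ℝ D ‖a‖) 0]; simp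
    · simp
  have hb := g.le_of_opNorm_le_of_le hg hna
  have hval : g (algebraMap ℝ D ‖a‖ - a) = (‖a‖ * r : ℝ) - g a := by
    rw [map_sub, Algebra.algebraMap_eq_smul_one, ← Complex.coe_smul, map_smul, h1]
    simp
  rw [hval] at hb
  have := (Complex.abs_re_le_norm _).trans hb
  rw [Complex.sub_re, Complex.ofReal_re, abs_le] at this
  rw [Complex.nonneg_iff]
  exact ⟨by linarith [this.2], him.symm⟩

/-- A functional on a unital C⋆-subalgebra whose norm is attained at the unit extends to a
positive functional. -/
theorem exists_positive_extension {C : Type*} [CStarAlgebra C] (j : C →⋆ₐ[ℂ] D)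
    (hj : Function.Injective j) (f : C →ₗ[ℂ] ℂ) (r : ℝ) (hf : ∀ c, ‖f c‖ ≤ r * ‖c‖)
    (h1 : f 1 = r) (hr : 0 ≤ r) : ∃ g : D →ₚ[ℂ] ℂ, ∀ c, g (j c) = f c := by
  let e := LinearEquiv.ofInjective (j.toAlgHom.toLinearMap) hj
  have he : ∀ c, ((e c : _) : D) = j c := fun c => rfl
  let f' : StrongDual ℂ (LinearMap.range j.toAlgHom.toLinearMap) :=
    (f ∘ₗ e.symm.toLinearMap).mkContinuous r (by
      intro x
      obtain ⟨c, rfl⟩ := e.surjective x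
      have : ‖e c‖ = ‖c‖ := by
        rw [← NonUnitalStarAlgHom.norm_map j hj c]; rfl
      simpa [this] using hf c)
  -- Hahn–Banach preserves the norm, so `‖g‖ ≤ r = g 1`, which forces positivity.
  obtain ⟨g, hg, hgn⟩ := exists_extension_norm_eq _ f'
  have hgj : ∀ c, g (j c) = f c := fun c => by
    rw [← he, hg]; simp [f']
  have hgr : ‖g‖ ≤ r := hgn.trans_le (LinearMap.mkContinuous_norm_le _ hr _)
  exact ⟨PositiveLinearMap.mk₀ g.toLinearMap fun x hx =>
    apply_nonneg_of_norm_le_apply_one g hgr (by rw [← map_one j, hgj, h1]) hx, hgj⟩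

end Extension

/-! ### Cyclic decomposition -/

section Cyclic

variable {C : Type*} [CStarAlgebra C] {K : Type*} [NormedAddCommGroup K] [InnerProductSpace ℂ K]
  [CompleteSpace K]

/-- Every unital representation is an orthogonal sum of cyclic ones. -/
theorem exists_orthogonal_cyclic (σ : C →⋆ₐ[ℂ] (K →L[ℂ] K)) :
    ∃ S : Set K, (∀ ξ ∈ S, ∀ η ∈ S, ξ ≠ η → ∀ c, ⟪ξ, σ c η⟫_ℂ = 0) ∧
      ∀ ζ : K, (∀ ξ ∈ S, ∀ c, ⟪σ c ξ, ζ⟫_ℂ = 0) → ζ = 0 := by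
  obtain ⟨S, hS⟩ := zorn_subset
    {S : Set K | ∀ ξ ∈ S, ∀ η ∈ S, ξ ≠ η → ∀ c, ⟪ξ, σ c η⟫_ℂ = 0} (by
      intro c hc hchain
      refine ⟨⋃₀ c, ?_, fun s hs => Set.subset_sUnion_of_mem hs⟩
      rintro ξ ⟨s, hs, hξ⟩ η ⟨t, ht, hη⟩ hne a
      rcases hchain.total hs ht with h | h
      · exact hc ht ξ (h hξ) η hη hne a
      · exact hc hs ξ hξ η (h hη) hne a)
  refine ⟨S, hS.prop, fun ζ hζ => ?_⟩
  have hstar : ∀ ξ ∈ S, ∀ c, ⟪ξ, σ c ζ⟫_ℂ = 0 := fun ξ hξ c => by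
    rw [← ContinuousLinearMap.adjoint_inner_left, ← ContinuousLinearMap.star_eq_adjoint,
      ← map_star]
    exact hζ ξ hξ _
  have hmem : insert ζ S ∈ {S : Set K | ∀ ξ ∈ S, ∀ η ∈ S, ξ ≠ η → ∀ c, ⟪ξ, σ c η⟫_ℂ = 0} := by
    rintro ξ (rfl | hξ) η (rfl | hη) hne c
    · exact (hne rfl).elim
    · rw [← inner_conj_symm, hζ η hη, map_zero]
    · exact hstar ξ hξ c
    · exact hS.prop ξ hξ η hη hne c
  -- Maximality puts `ζ` in `S`, so `ζ` is orthogonal to its own cyclic subspace, which contains `σ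
  -- 1 ζ = ζ`.
  have hζS : ζ ∈ S := hS.le_of_ge hmem (Set.subset_insert _ _) (Set.mem_insert _ _)
  simpa using hζ ζ hζS 1

end Cyclic

/-! ### Direct sums of representations -/

section DirectSum

variable {D : Type*} [NonUnitalCStarAlgebra D] {ι : Type*} {L : ι → Type*}
  [∀ i, NormedAddCommGroup (L i)] [∀ i, InnerProductSpace ℂ (L i)] [∀ i, CompleteSpace (L i)]

/-- The Hilbert space direct sum of a family of representations. -/
noncomputable def directSumRep (τ : ∀ i, D →⋆ₙₐ[ℂ] (L i →L[ℂ] L i)) :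
    D →⋆ₙₐ[ℂ] (lp L 2 →L[ℂ] lp L 2) where
  toFun d := lp.mapCLM 2 (fun i => τ i d) (norm_nonneg d)
    fun i => NonUnitalStarAlgHom.norm_apply_le (τ i) d
  map_smul' r d := by ext x i; simp
  map_zero' := by ext x i; simp
  map_add' a b := by ext x i; simp
  map_mul' a b := by ext x i; simp
  map_star' a := by
    rw [ContinuousLinearMap.star_eq_adjoint, ContinuousLinearMap.eq_adjoint_iff]
    intro x y
    rw [lp.inner_eq_tsum, lp.inner_eq_tsum]
    refine tsum_congr fun i => ?_
    simp [map_star, ContinuousLinearMap.star_eq_adjoint, ContinuousLinearMap.adjoint_inner_left]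

theorem directSumRep_apply (τ : ∀ i, D →⋆ₙₐ[ℂ] (L i →L[ℂ] L i)) (d : D) (x : lp L 2) (i : ι) :
    directSumRep τ d x i = τ i d (x i) := rfl

end DirectSum

universe u w

/-- Two linear maps with the same Gram matrices, the first with dense range, differ by an
isometry. -/
theorem exists_isometry_of_inner_eq {E : Type*} [AddCommGroup E] [Module ℂ E]
    {K : Type*} [NormedAddCommGroup K] [InnerProductSpace ℂ K] [CompleteSpace K]
    {L : Type*} [NormedAddCommGroup L] [InnerProductSpace ℂ L] [CompleteSpace L]
    (e : E →ₗ[ℂ] K) (f : E →ₗ[ℂ] L) (he : DenseRange e)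
    (h : ∀ x y, ⟪f x, f y⟫_ℂ = ⟪e x, e y⟫_ℂ) :
    ∃ V : K →L[ℂ] L, (∀ x, ‖V x‖ = ‖x‖) ∧ ∀ x, V (e x) = f x := by
  have hn : ∀ x, ‖f x‖ = ‖e x‖ := fun x => by
    rw [@norm_eq_sqrt_re_inner ℂ, @norm_eq_sqrt_re_inner ℂ, h]
  have hV : ∀ x, f.extendOfNorm e (e x) = f x :=
    LinearMap.extendOfNorm_eq he ⟨1, fun x => by rw [one_mul, hn]⟩
  refine ⟨f.extendOfNorm e, fun x => ?_, hV⟩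
  refine he.induction_on (p := fun x => ‖f.extendOfNorm e x‖ = ‖x‖) x
    (isClosed_eq (by fun_prop) (by fun_prop)) fun x => ?_
  rw [hV, hn]

/-! ### Dilation of representations -/

section Unital

variable {C : Type*} [CStarAlgebra C] {D : Type u} [CStarAlgebra D] [PartialOrder D]
  [StarOrderedRing D] {K : Type w} [NormedAddCommGroup K] [InnerProductSpace ℂ K]
  [CompleteSpace K]

/-- Vector functionals of a representation extend to positive functionals on a larger
C⋆-algebra. -/
theorem exists_positive_extension_vector (j : C →⋆ₐ[ℂ] D) (hj : Function.Injective j)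
    (σ : C →⋆ₐ[ℂ] (K →L[ℂ] K)) (ξ : K) :
    ∃ g : D →ₚ[ℂ] ℂ, ∀ c, g (j c) = ⟪ξ, σ c ξ⟫_ℂ := by
  let f : C →ₗ[ℂ] ℂ :=
    { toFun := fun c => ⟪ξ, σ c ξ⟫_ℂ
      map_add' := fun a b => by simp
      map_smul' := fun r a => by simp }
  refine exists_positive_extension j hj f (‖ξ‖ ^ 2) (fun c => ?_) ?_ (by positivity)
  · calc ‖⟪ξ, σ c ξ⟫_ℂ‖ ≤ ‖ξ‖ * ‖σ c ξ‖ := norm_inner_le_norm _ _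
      _ ≤ ‖ξ‖ * (‖c‖ * ‖ξ‖) := by
        gcongr
        exact (σ c).le_of_opNorm_le (NonUnitalStarAlgHom.norm_apply_le σ c) ξ
      _ = ‖ξ‖ ^ 2 * ‖c‖ := by ring
  · simp [f]

/-- A representation of a unital C⋆-subalgebra is contained in the restriction of a
representation of the larger algebra. -/
theorem exists_dilation_unital (j : C →⋆ₐ[ℂ] D) (hj : Function.Injective j)
    (σ : C →⋆ₐ[ℂ] (K →L[ℂ] K)) :
    ∃ (L : Type (max u w)) (_ : NormedAddCommGroup L) (_ : InnerProductSpace ℂ L)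
      (_ : CompleteSpace L) (τ : D →⋆ₙₐ[ℂ] (L →L[ℂ] L)) (V : K →L[ℂ] L),
      (∀ x, ‖V x‖ = ‖x‖) ∧ ∀ c, τ (j c) ∘L V = V ∘L σ c := by
  classical
  obtain ⟨S, horth, hdense⟩ := exists_orthogonal_cyclic σ
  choose g hg using exists_positive_extension_vector j hj σ
  let e : (S →₀ C) →ₗ[ℂ] K := Finsupp.lsum ℂ fun ξ : S =>
    { toFun := fun c => σ c ξ
      map_add' := fun a b => by simp
      map_smul' := fun r a => by simp }
  let ι : ∀ ξ : S, C →ₗ[ℂ] (g ξ).GNS := fun ξ =>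
    { toFun := fun c => (((g ξ).toPreGNS (j c) : (g ξ).PreGNS) : (g ξ).GNS)
      map_add' := fun a b => by simp [UniformSpace.Completion.coe_add]
      map_smul' := fun r a => by simp [UniformSpace.Completion.coe_smul] }
  let f : (S →₀ C) →ₗ[ℂ] lp (fun ξ : S => (g ξ).GNS) 2 :=
    Finsupp.lsum ℂ fun ξ : S => lp.lsingle (𝕜 := ℂ) 2 ξ ∘ₗ ι ξ
  have he1 : ∀ ξ c, e (Finsupp.single ξ c) = σ c ξ := fun ξ c => by simp [e]
  have hf1 : ∀ ξ c, f (Finsupp.single ξ c) = lp.single 2 ξ (ι ξ c) := fun ξ c => by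
    simp [f]
  -- Gram matrices agree: on one cyclic summand both equal `g ξ (j (c* d))`, and distinct summands
  -- are orthogonal on both sides.
  have hin : ∀ (ξ η : K) (c d : C), ⟪σ c ξ, σ d η⟫_ℂ = ⟪ξ, σ (star c * d) η⟫_ℂ := by
    intro ξ η c d
    rw [map_mul, map_star, ContinuousLinearMap.star_eq_adjoint, mul_apply_eq_comp,
      ContinuousLinearMap.adjoint_inner_right]
  have hinner : ∀ x y, ⟪f x, f y⟫_ℂ = ⟪e x, e y⟫_ℂ := by
    intro x y
    induction x using Finsupp.induction_linear with
    | zero => simp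
    | add x₁ x₂ h₁ h₂ => simp only [map_add, inner_add_left, h₁, h₂]
    | single ξ c =>
      induction y using Finsupp.induction_linear with
      | zero => simp
      | add y₁ y₂ h₁ h₂ => simp only [map_add, inner_add_right, h₁, h₂]
      | single η d =>
        rw [hf1, hf1, he1, he1, hin, lp.inner_single_left]
        by_cases h : ξ = η
        · subst h
          rw [lp.single_apply_self, ← hg]
          simp [ι, UniformSpace.Completion.inner_coe, PositiveLinearMap.preGNS_inner_def, map_star]
        · rw [lp.single_apply_ne _ _ _ h, inner_zero_right,
            horth ξ ξ.2 η η.2 (fun h' => h (Subtype.ext h'))]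
  have hde : DenseRange e := by
    change Dense ((LinearMap.range e : Submodule ℂ K) : Set K)
    rw [Submodule.dense_iff_topologicalClosure_eq_top, Submodule.topologicalClosure_eq_top_iff,
      Submodule.eq_bot_iff]
    intro ζ hζ
    refine hdense ζ fun ξ hξ c => ?_
    rw [← he1 ⟨ξ, hξ⟩ c]
    exact (Submodule.mem_orthogonal _ _).1 hζ _ ⟨_, rfl⟩
  obtain ⟨V, hVn, hV⟩ := exists_isometry_of_inner_eq e f hde hinner
  refine ⟨_, _, _, inferInstance, directSumRep fun ξ : S => (g ξ).gnsNonUnitalStarAlgHom, V,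
    hVn, fun c => ?_⟩
  ext1 x
  refine hde.induction_on (p := fun x => (directSumRep (fun ξ : S =>
    (g ξ).gnsNonUnitalStarAlgHom) (j c) ∘L V) x = (V ∘L σ c) x) x
    (isClosed_eq (by fun_prop) (by fun_prop)) fun y => ?_
  induction y using Finsupp.induction_linear with
  | zero => simp
  | add y₁ y₂ h₁ h₂ => rw [map_add, map_add, map_add, h₁, h₂]
  | single ξ d =>
    have : σ c (e (Finsupp.single ξ d)) = e (Finsupp.single ξ (c * d)) := by
      rw [he1, he1, map_mul]; rfl
    rw [ContinuousLinearMap.comp_apply, ContinuousLinearMap.comp_apply, this, hV, hV, hf1, hf1]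
    ext η
    rw [directSumRep_apply]
    by_cases h : η = ξ
    · subst h
      rw [lp.single_apply_self, lp.single_apply_self]
      simp [ι]
    · rw [lp.single_apply_ne _ _ _ h, lp.single_apply_ne _ _ _ h, map_zero]

end Unital

/-- A representation of a C⋆-subalgebra is contained in the restriction of a representation of
the larger algebra. -/
theorem exists_dilation {A : Type*} [NonUnitalCStarAlgebra A] {E : Type u}
    [NonUnitalCStarAlgebra E] {K : Type w} [NormedAddCommGroup K] [InnerProductSpace ℂ K]
    [CompleteSpace K] (j : A →⋆ₙₐ[ℂ] E) (hj : Function.Injective j) (ρ : A →⋆ₙₐ[ℂ] (K →L[ℂ] K)) :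
    ∃ (L : Type (max u w)) (_ : NormedAddCommGroup L) (_ : InnerProductSpace ℂ L)
      (_ : CompleteSpace L) (τ : E →⋆ₙₐ[ℂ] (L →L[ℂ] L)) (V : K →L[ℂ] L),
      (∀ x, ‖V x‖ = ‖x‖) ∧ ∀ a, τ (j a) ∘L V = V ∘L ρ a := by
  -- Fresh units are adjoined to both algebras, since `j` and `ρ` need not be unital even when units
  -- exist.
  let _ : PartialOrder (Unitization ℂ E) := CStarAlgebra.spectralOrder _
  let _ : StarOrderedRing (Unitization ℂ E) := CStarAlgebra.spectralOrderedRing _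
  obtain ⟨L, i₁, i₂, i₃, τ, V, hV, h⟩ := exists_dilation_unital (Unitization.starMap j)
    (Unitization.starMap_injective hj) (Unitization.starLift ρ)
  refine ⟨L, i₁, i₂, i₃, τ.comp (Unitization.inrNonUnitalStarAlgHom ℂ E), V, hV, fun a => ?_⟩
  have hρ : Unitization.starLift ρ (a : Unitization ℂ A) = ρ a := by
    rw [← Unitization.starLift_symm_apply_apply, Equiv.symm_apply_apply]
  have := h (a : Unitization ℂ A)
  rwa [hρ, Unitization.starMap_inr] at this

/-! ### Compression by an isometry -/

section Compression

variable {K : Type*} [NormedAddCommGroup K] [InnerProductSpace ℂ K] [CompleteSpace K]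
  {L : Type*} [NormedAddCommGroup L] [InnerProductSpace ℂ L] [CompleteSpace L]

open ContinuousLinearMap in
theorem adjoint_comp_self_of_norm_eq {V : K →L[ℂ] L} (hV : ∀ x, ‖V x‖ = ‖x‖) :
    adjoint V ∘L V = ContinuousLinearMap.id ℂ K :=
  (ContinuousLinearMap.norm_map_iff_adjoint_comp_self V).1 hV

open ContinuousLinearMap in
/-- Conjugation by an isometry, as a ⋆-homomorphism. -/
noncomputable def conjIsometry (V : K →L[ℂ] L) (hV : ∀ x, ‖V x‖ = ‖x‖) :
    (K →L[ℂ] K) →⋆ₙₐ[ℂ] (L →L[ℂ] L) where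
  toFun T := V ∘L T ∘L adjoint V
  map_smul' r T := by ext; simp
  map_zero' := by simp
  map_add' S T := by simp
  map_mul' S T := by
    have h : ∀ x, adjoint V (V x) = x := fun x =>
      congr($(adjoint_comp_self_of_norm_eq hV) x)
    ext x; simp [h]
  map_star' T := by
    simp [star_eq_adjoint, adjoint_comp, comp_assoc]

open ContinuousLinearMap in
theorem conjIsometry_injective (V : K →L[ℂ] L) (hV : ∀ x, ‖V x‖ = ‖x‖) :
    Function.Injective (conjIsometry V hV) := by
  have h : ∀ x, adjoint V (V x) = x := fun x =>
    congr($(adjoint_comp_self_of_norm_eq hV) x)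
  intro S T hST
  ext x
  have := congr(adjoint V ($hST (V x)))
  simpa [conjIsometry, h] using this

open ContinuousLinearMap in
/-- The compression of a representation by an isometry. -/
noncomputable def compression {E : Type*} [NonUnitalCStarAlgebra E] [PartialOrder E]
    [StarOrderedRing E] (τ : E →⋆ₙₐ[ℂ] (L →L[ℂ] L)) (V : K →L[ℂ] L) (hV : ∀ x, ‖V x‖ = ‖x‖) :
    E →CP (K →L[ℂ] K) where
  toFun b := adjoint V ∘L τ b ∘L V
  map_add' a b := by simp
  map_smul' r a := by ext; simp
  map_cstarMatrix_nonneg' k M hM := by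
    -- Conjugating entries by `V` moves the matrix to `L`, where it becomes `P * M.map τ * P` with
    -- `P` the diagonal projection of entries `V V*`.
    refine nonneg_of_map_nonneg (CStarMatrix.mapₙₐ (n := Fin k) (conjIsometry V hV))
      (CStarMatrix.map_injective (conjIsometry_injective V hV)) ?_
    let P : CStarMatrix (Fin k) (Fin k) (L →L[ℂ] L) :=
      CStarMatrix.ofMatrix (Matrix.diagonal fun _ => V ∘L adjoint V)
    have hP : star P = P := by
      ext1 i m
      rw [CStarMatrix.star_apply]
      by_cases h : i = m
      · subst h
        simp [P, star_eq_adjoint, adjoint_comp]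
      · simp [P, Matrix.diagonal_apply_ne _ h, Matrix.diagonal_apply_ne' _ h]
    have hM' : 0 ≤ M.map τ := CompletelyPositiveMapClass.map_cstarMatrix_nonneg' τ k M hM
    have := star_left_conjugate_nonneg hM' P
    convert this using 1
    rw [hP]
    ext1 i m
    rw [CStarMatrix.mul_apply, Finset.sum_eq_single m, CStarMatrix.mul_apply,
      Finset.sum_eq_single i]
    · simp [P, conjIsometry, ContinuousLinearMap.mul_def, comp_assoc]
    · intro b _ hb
      simp [P, Matrix.diagonal_apply_ne' _ hb]
    · simp
    · intro b _ hb
      simp [P, Matrix.diagonal_apply_ne _ hb]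
    · simp

end Compression

open MulOpposite

/-- Positive elements of a C⋆-algebra have the form `star y * y`. -/
theorem exists_eq_star_mul_self {X : Type*} [NonUnitalCStarAlgebra X] [PartialOrder X]
    [StarOrderedRing X] {x : X} (hx : 0 ≤ x) : ∃ y, x = star y * y :=
  CStarAlgebra.nonneg_iff_eq_star_mul_self.1 hx

/-! ### Complete positivity and opposite algebras -/

section Opposite

variable {A : Type*} [NonUnitalCStarAlgebra A] [PartialOrder A] [StarOrderedRing A]
  {B : Type*} [NonUnitalCStarAlgebra B] [PartialOrder B] [StarOrderedRing B]

/-- Transposition turns positive matrices over an algebra into positive matrices over the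
opposite algebra. -/
theorem transpose_map_op_nonneg {k : ℕ} {M : CStarMatrix (Fin k) (Fin k) A} (hM : 0 ≤ M) :
    0 ≤ M.transpose.map op := by
  obtain ⟨N, rfl⟩ := exists_eq_star_mul_self hM
  -- Transposition reverses matrix products and `op` reverses products of entries, so `N* N` becomes
  -- `P P*` with `P` the transpose of `N` over the opposite algebra.
  convert mul_star_self_nonneg (N.transpose.map op) using 1
  ext1 i m
  simp [CStarMatrix.mul_apply, CStarMatrix.star_apply, Finset.op_sum]

theorem transpose_map_unop_nonneg {k : ℕ} {M : CStarMatrix (Fin k) (Fin k) Aᵐᵒᵖ} (hM : 0 ≤ M) :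
    0 ≤ M.transpose.map unop := by
  obtain ⟨N, rfl⟩ := exists_eq_star_mul_self hM
  convert mul_star_self_nonneg (N.transpose.map unop) using 1
  ext1 i m
  simp [CStarMatrix.mul_apply, CStarMatrix.star_apply, Finset.unop_sum]

/-- A completely positive map is completely positive between the opposite algebras. -/
def opCP (φ : A →CP B) : Aᵐᵒᵖ →CP Bᵐᵒᵖ where
  toFun a := op (φ a.unop)
  map_add' a b := by simp
  map_smul' r a := by simp
  map_cstarMatrix_nonneg' k M hM := by
    -- Transposition is used on the way into `A` and again on the way out of `B`; the two cancel, as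
    -- `φ` acts entrywise.
    have := transpose_map_op_nonneg (φ.map_cstarMatrix_nonneg' k _ (transpose_map_unop_nonneg hM))
    exact this

/-- A ⋆-homomorphism, between the opposite algebras. -/
def opHom {A B : Type*} [NonUnitalCStarAlgebra A] [NonUnitalCStarAlgebra B]
    (π : A →⋆ₙₐ[ℂ] B) : Aᵐᵒᵖ →⋆ₙₐ[ℂ] Bᵐᵒᵖ where
  toFun a := op (π a.unop)
  map_smul' r a := by simp
  map_zero' := by simp
  map_add' a b := by simp
  map_mul' a b := by simp
  map_star' a := by simp [map_star]

/-- The double opposite of an algebra is the algebra. -/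
def opOpHom (A : Type*) [NonUnitalCStarAlgebra A] : A →⋆ₙₐ[ℂ] Aᵐᵒᵖᵐᵒᵖ where
  toFun a := op (op a)
  map_smul' r a := by simp
  map_zero' := by simp
  map_add' a b := by simp
  map_mul' a b := by simp
  map_star' a := by simp

/-- Composition of completely positive maps. -/
def compCP {C : Type*} [NonUnitalCStarAlgebra C] [PartialOrder C] [StarOrderedRing C]
    (ψ : B →CP C) (φ : A →CP B) : A →CP C where
  toLinearMap := ψ.toLinearMap ∘ₗ φ.toLinearMap
  map_cstarMatrix_nonneg' k M hM :=
    ψ.map_cstarMatrix_nonneg' k _ (φ.map_cstarMatrix_nonneg' k M hM)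

/-- ⋆-homomorphisms are completely positive. -/
def homCP (π : A →⋆ₙₐ[ℂ] B) : A →CP B where
  toFun := π
  map_add' := map_add π
  map_smul' := map_smul π
  map_cstarMatrix_nonneg' := CompletelyPositiveMapClass.map_cstarMatrix_nonneg' π

end Opposite

/-! ### Rank of the opposite algebra -/

section Rank

variable {B : Type*} [NonUnitalCStarAlgebra B]

/-- The ⋆-subalgebras of an algebra are those of its opposite. -/
def opSubalgebra : NonUnitalStarSubalgebra ℂ B ≃o NonUnitalStarSubalgebra ℂ Bᵐᵒᵖ where
  toFun S :=
    { carrier := unop ⁻¹' S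
      add_mem' := fun ha hb => S.add_mem' ha hb
      zero_mem' := S.zero_mem'
      mul_mem' := fun ha hb => S.mul_mem' hb ha
      smul_mem' := fun c _ ha => S.smul_mem' c ha
      star_mem' := fun ha => S.star_mem' ha }
  invFun S :=
    { carrier := op ⁻¹' S
      add_mem' := fun ha hb => S.add_mem' ha hb
      zero_mem' := S.zero_mem'
      mul_mem' := fun ha hb => S.mul_mem' hb ha
      smul_mem' := fun c _ ha => S.smul_mem' c ha
      star_mem' := fun ha => S.star_mem' ha }
  left_inv _ := rfl
  right_inv _ := rfl
  map_rel_iff' := ⟨fun h x hx => h (x := op x) hx, fun h _ hx => h hx⟩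

theorem finrank_opSubalgebra (S : NonUnitalStarSubalgebra ℂ B) :
    Module.finrank ℂ (opSubalgebra S) = Module.finrank ℂ S :=
  LinearEquiv.finrank_eq
    { toFun := fun x => (⟨x.1.unop, x.2⟩ : S)
      invFun := fun x => (⟨op x.1, x.2⟩ : opSubalgebra S)
      map_add' := fun _ _ => rfl
      map_smul' := fun _ _ => rfl
      left_inv := fun _ => rfl
      right_inv := fun _ => rfl }

theorem commutative_opSubalgebra (S : NonUnitalStarSubalgebra ℂ B) :
    (∀ x ∈ opSubalgebra S, ∀ y ∈ opSubalgebra S, x * y = y * x) ↔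
      ∀ x ∈ S, ∀ y ∈ S, x * y = y * x :=
  ⟨fun h x hx y hy => congrArg unop (h (op y) hy (op x) hx),
    fun h x hx y hy => congrArg op (h y.unop hy x.unop hx)⟩

theorem cstarRank_op (B : Type*) [NonUnitalCStarAlgebra B] : cstarRank Bᵐᵒᵖ = cstarRank B := by
  unfold cstarRank
  congr 1
  ext d
  refine (opSubalgebra (B := B)).surjective.exists.trans (exists_congr fun S => ?_)
  rw [finrank_opSubalgebra]
  refine and_congr_left fun _ => ?_
  simp only [Maximal, commutative_opSubalgebra, (opSubalgebra (B := B)).surjective.forall,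
    OrderIso.le_iff_le]

end Rank

/-! ### Comparison of approximation ranks and entropies -/

section Entropy

variable {A : Type*} [NonUnitalCStarAlgebra A] [PartialOrder A] [StarOrderedRing A]
  {A' : Type*} [NonUnitalCStarAlgebra A'] [PartialOrder A'] [StarOrderedRing A']
  {H : Type*} [NormedAddCommGroup H] [InnerProductSpace ℂ H] [CompleteSpace H]
  {K : Type*} [NormedAddCommGroup K] [InnerProductSpace ℂ K] [CompleteSpace K]

/-- An approximating triple for a faithful representation of an algebra yields one of the same
rank for any representation of an algebra embedded in the opposite one. -/
theorem exists_CPA_opposite {π : A →⋆ₙₐ[ℂ] (H →L[ℂ] H)} (hπ : Function.Injective π)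
    (ρ : A' →⋆ₙₐ[ℂ] (K →L[ℂ] K)) (ω : A' →⋆ₙₐ[ℂ] Aᵐᵒᵖ) (hω : Function.Injective ω)
    {Ω : Set A} {Ω' : Set A'} (hΩ : ∀ a ∈ Ω', (ω a).unop ∈ Ω) {δ : ℝ} (T : CPA π Ω δ) :
    ∃ T' : CPA ρ Ω' δ, T'.rank = T.rank := by
  obtain ⟨B, φ, ψ, hφ, hψ, happ⟩ := T
  have hj : Function.Injective ((opHom π).comp ω) := fun a b hab =>
    hω (unop_injective (hπ (op_injective hab)))
  obtain ⟨L, _, _, _, τ, V, hV, h⟩ := exists_dilation ((opHom π).comp ω) hj ρ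
  have hVle : ‖V‖ ≤ 1 := V.opNorm_le_bound zero_le_one fun x => by rw [hV, one_mul]
  have hcomp : ∀ x, ‖compression τ V hV x‖ ≤ ‖x‖ := fun x =>
    calc ‖ContinuousLinearMap.adjoint V ∘L τ x ∘L V‖
        ≤ ‖ContinuousLinearMap.adjoint V‖ * (‖τ x‖ * ‖V‖) :=
          (ContinuousLinearMap.opNorm_comp_le _ _).trans
            (mul_le_mul_of_nonneg_left (ContinuousLinearMap.opNorm_comp_le _ _) (norm_nonneg _))
      _ ≤ 1 * (‖x‖ * 1) := by
          gcongr
          · rwa [LinearIsometryEquiv.norm_map]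
          · exact NonUnitalStarAlgHom.norm_apply_le τ x
      _ = ‖x‖ := by ring
  have hρ : ∀ a, compression τ V hV (op (π (ω a).unop)) = ρ a := fun a =>
    calc ContinuousLinearMap.adjoint V ∘L (τ (op (π (ω a).unop)) ∘L V)
        = ContinuousLinearMap.adjoint V ∘L (V ∘L ρ a) := congrArg _ (h a)
      _ = ρ a := by
        rw [← ContinuousLinearMap.comp_assoc, adjoint_comp_self_of_norm_eq hV]
        rfl
  refine ⟨{
    B := Bᵐᵒᵖ
    finiteDimensional := Module.Finite.equiv (opLinearEquiv ℂ)
    φ := compCP (opCP φ) (homCP ω)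
    ψ := compCP (compression τ V hV) (opCP ψ)
    φ_contractive := fun a =>
      (hφ (ω a).unop).trans (NonUnitalStarAlgHom.norm_apply_le ω a)
    ψ_contractive := fun b => (hcomp (op (ψ b.unop))).trans (hψ b.unop)
    approx := fun a ha => ?_ }, cstarRank_op B⟩
  change ‖compression τ V hV (op (ψ (φ (ω a).unop))) - ρ a‖ < δ
  -- The new error is the compression of the old one, and compression is contractive.
  rw [← hρ a, ← map_sub]
  exact (hcomp _).trans_lt (happ _ (hΩ a ha))

/-- Allowing any `A'` embedded in `Aᵐᵒᵖ` serves both directions: `Aᵐᵒᵖ` itself, and `A` inside its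
double opposite. -/
theorem rcp_le_rcp_opposite {π : A →⋆ₙₐ[ℂ] (H →L[ℂ] H)} (hπ : Function.Injective π)
    (ρ : A' →⋆ₙₐ[ℂ] (K →L[ℂ] K)) (ω : A' →⋆ₙₐ[ℂ] Aᵐᵒᵖ) (hω : Function.Injective ω)
    {Ω : Set A} {Ω' : Set A'} (hΩ : ∀ a ∈ Ω', (ω a).unop ∈ Ω) (δ : ℝ) :
    rcp ρ Ω' δ ≤ rcp π Ω δ := by
  refine le_iInf fun T => ?_
  obtain ⟨T', hT'⟩ := exists_CPA_opposite hπ ρ ω hω hΩ T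
  exact (iInf_le _ T').trans_eq (by rw [hT'])

/-- The approximation rank of a set equals that of the corresponding set of the opposite
algebra, in any faithful representations. -/
theorem rcp_opposite {π : A →⋆ₙₐ[ℂ] (H →L[ℂ] H)} (hπ : Function.Injective π)
    {ρ : Aᵐᵒᵖ →⋆ₙₐ[ℂ] (K →L[ℂ] K)} (hρ : Function.Injective ρ) (Ω : Set A) (δ : ℝ) :
    rcp π Ω δ = rcp ρ (unop ⁻¹' Ω) δ :=
  le_antisymm
    (rcp_le_rcp_opposite hρ π (opOpHom A) (fun _ _ h => op_injective (op_injective h))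
      (fun _ ha => ha) δ)
    (rcp_le_rcp_opposite hπ ρ (NonUnitalStarAlgHom.id ℂ Aᵐᵒᵖ) Function.injective_id
      (fun _ ha => ha) δ)

theorem orbit_opAut {A : Type*} [NonUnitalCStarAlgebra A] (α : A ≃⋆ₐ[ℂ] A) (Ω : Set A) (n : ℕ) :
    orbit (opAut α) (unop ⁻¹' Ω) n = unop ⁻¹' orbit α Ω n := by
  have hit : ∀ (k : ℕ) (a : Aᵐᵒᵖ), ((opAut α)^[k] a).unop = α^[k] a.unop := by
    intro k
    induction k with
    | zero => exact fun a => rfl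
    | succ k ih => exact fun a => ih _
  ext a
  simp only [orbit, Set.mem_iUnion, Set.mem_image, Set.mem_preimage]
  refine exists_congr fun k => exists_congr fun _ => ⟨?_, ?_⟩
  · rintro ⟨b, hb, rfl⟩
    exact ⟨b.unop, hb, (hit k b).symm⟩
  · rintro ⟨b, hb, hba⟩
    exact ⟨op b, hb, unop_injective ((hit k _).trans hba)⟩

theorem htSet_opposite {π : A →⋆ₙₐ[ℂ] (H →L[ℂ] H)} (hπ : Function.Injective π)
    {ρ : Aᵐᵒᵖ →⋆ₙₐ[ℂ] (K →L[ℂ] K)} (hρ : Function.Injective ρ) (α : A ≃⋆ₐ[ℂ] A) (Ω : Set A) :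
    htSet π α Ω = htSet ρ (opAut α) (unop ⁻¹' Ω) := by
  simp only [htSet, htDelta, orbit_opAut, rcp_opposite hπ hρ]

end Entropy

end VBEntropy

/-- The Voiculescu–Brown entropy of an automorphism of an exact C⋆-algebra equals that of the
induced automorphism of the opposite algebra, whichever faithful ⋆-representations of the two
algebras are used to compute them. -/
theorem mainTheorem7 {A : Type*} [NonUnitalCStarAlgebra A] [PartialOrder A] [StarOrderedRing A]
    (hA : VBEntropy.IsExact A) (α : A ≃⋆ₐ[ℂ] A)
    {H : Type*} [NormedAddCommGroup H] [InnerProductSpace ℂ H] [CompleteSpace H]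
    (π : A →⋆ₙₐ[ℂ] (H →L[ℂ] H)) (hπ : Function.Injective π)
    {K : Type*} [NormedAddCommGroup K] [InnerProductSpace ℂ K] [CompleteSpace K]
    (ρ : Aᵐᵒᵖ →⋆ₙₐ[ℂ] (K →L[ℂ] K)) (hρ : Function.Injective ρ) :
    VBEntropy.ht π α = VBEntropy.ht ρ (VBEntropy.opAut α) := by
  refine Equiv.iSup_congr (Equiv.finsetCongr MulOpposite.opEquiv) fun Ω => ?_
  rw [VBEntropy.htSet_opposite hπ hρ]
  congr 1
  ext a
  constructor
  · intro h
    obtain ⟨b, hb, rfl⟩ := Finset.mem_map.1 h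
    exact hb
  · intro h
    exact Finset.mem_map.2 ⟨a.unop, h, rfl⟩
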